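/- Let $T,\alpha,\beta>0$ and let $\mathrm{BV}(0,T)$ be the space of functions $u\in L^1(0,T)$ whose distributional derivative $Du$ is a finite signed Radon measure on $(0,T)$; it is contained in $L^2(0,T)$. Write $\|\cdot\|_M$ for the total variation norm of such measures (a function $w$ being identified with the measure $w\,\mathrm{d}x$) and, for $u\in\mathrm{BV}(0,T)$, set $$\operatorname{TGV}(u)=\inf_{w\in \mathrm{BV}(0,T)}\ \alpha\|Du-w\|_M+\beta\|Dw\|_M .$$ For $x_0,x_1\in(0,T)$ let $S_{x_0}=1_{(x_0,T)}$, and let $K_{x_1}(x)=1_{(0,x_1)}(x)\,(x_1-x)$ if $x_1<T/2$ and $K_{x_1}(x)=1_{(x_1,T)}(x)\,(x-x_1)$ if $x_1\ge T/2$. Let $f:L^2(0,T)\to\mathbb R$ be Fréchet differentiable (not necessarily convex), with gradient $\nabla f(u)\in L^2(0,T)$ at $u$. Let $\bar u\in \mathrm{BV}(0,T)$ be a minimizer of $J(u)=f(u)+\operatorname{TGV}(u)$ over $\mathrm{BV}(0,T)$, let $\bar w\in\mathrm{BV}(0,T)$ be such that $\operatorname{TGV}(\bar u)=\alpha\|D\bar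 u-\bar w\|_M+\beta\|D\bar w\|_M$, and set $$\bar p(x)=\int_0^x\nabla f(\bar u)\,\mathrm{d}t,\qquad \bar P(x)=-\int_0^x\bar p\,\mathrm{d}t .$$ Assume that there are $N_S,N_K\ge 0$ and points $\bar x^S_1,\dots,\bar x^S_{N_S}$, $\bar x^K_1,\dots,\bar x^K_{N_K}$ in $(0,T)$ with $$\{x\in(0,T)\mid \bar p(x)=\pm\alpha\}=\{\bar x^S_j\}_{j=1}^{N_S},\qquad \{x\in(0,T)\mid \bar P(x)=\pm\beta\}=\{\bar x^K_j\}_{j=1}^{N_K}.$$ Put $\bar\sigma^S_j=\bar p(\bar x^S_j)/\alpha\in\{-1,1\}$ and $\bar\sigma^K_j=\bar P(\bar x^K_j)/\beta\in\{-1,1\}$ and, for $\lambda^S\in\mathbb R^{N_S}$, $\lambda^K\in\mathbb R^{N_K}$, $a,b\in\mathbb R$, $$u(\lambda^S,\lambda^K,a,b)=\frac1\alpha\sum_{j=1}^{N_S}\bar\sigma^S_j\lambda^S_jS_{\bar x^S_j}+\frac1\beta\sum_{j=1}^{N_K}\bar\sigma^K_j\lambda^K_jK_{\bar x^K_j}+ax+b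 .$$ Then there are $\bar\lambda^S\in\mathbb R^{N_S}$ and $\bar\lambda^K\in\mathbb R^{N_K}$ with nonnegative entries and $\bar a,\bar b\in\mathbb R$ such that $\bar u=u(\bar\lambda^S,\bar\lambda^K,\bar a,\bar b)$ a.e. on $(0,T)$; the tuple $(\bar\lambda^S,\bar\lambda^K,\bar a,\bar b)$ is a solution to $$\min_{\lambda^S\ge0,\ \lambda^K\ge 0,\ a,b\in\mathbb R}\Big[f\big(u(\lambda^S,\lambda^K,a,b)\big)+\sum_{j=1}^{N_S}\lambda^S_j+\sum_{j=1}^{N_K}\lambda^K_j\Big];$$ and moreover, a.e. on $(0,T)$, $$\bar w=\frac1\beta\sum_{j=1}^{N_K}\bar\sigma^K_j\bar\lambda^K_j\,DK_{\bar x^K_j}+\bar a,\qquad\text{where } DK_{x}=S_{x}\ \text{ if } x\ge T/2,\quad DK_{x}=S_{x}-1\ \text{ if } x<T/2,$$ and $$\operatorname{TGV}(\bar u)=\sum_{j=1}^{N_S}\bar\lambda^S_j+\sum_{j=1}^{N_K}\bar\lambda^K_j .$$ -/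

import Mathlib

open MeasureTheory Set
open scoped ContDiff Gradient

noncomputable section

namespace TGV1D

/-- Lebesgue measure on the interval `(0, T)`. -/
abbrev leb (T : ℝ) : Measure ℝ := volume.restrict (Ioo 0 T)

/-- The real Hilbert space `L²(0, T)`. -/
abbrev L2 (T : ℝ) : Type := Lp ℝ 2 (leb T)

/-- Test functions: `φ ∈ C_c^∞(0, T)`. -/
structure IsTest (T : ℝ) (φ : ℝ → ℝ) : Prop where
  smooth : ContDiff ℝ ∞ φ
  compact : HasCompactSupport φ
  support : tsupport φ ⊆ Ioo 0 T

/-- `μ` is the distributional derivative `Du` of `u ∈ L¹(0, T)`, and `Du` is a finite Radon measure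
on `(0, T)`. An element of `M(0, T)` is represented by a finite signed Borel measure on `ℝ`
concentrated on `(0, T)`. -/
structure IsDistribDeriv (T : ℝ) (u : ℝ → ℝ) (μ : SignedMeasure ℝ) : Prop where
  integrable : IntegrableOn u (Ioo 0 T)
  concentrated : μ.variation (Ioo 0 T)ᶜ = 0
  integral_eq : ∀ φ : ℝ → ℝ, IsTest T φ →
    ∫ x in Ioo 0 T, u x * deriv φ x = - ∫ᵛ x, φ x ∂<•μ

/-- `u ∈ BV(0, T)`: an integrable function whose distributional derivative is a finite measure. -/
def MemBV (T : ℝ) (u : ℝ → ℝ) : Prop := ∃ μ : SignedMeasure ℝ, IsDistribDeriv T u μ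

/-- The Radon norm `‖μ‖_M`, i.e. the total variation of `μ`. -/
def radonNorm (μ : SignedMeasure ℝ) : ℝ := (μ.variation univ).toReal

/-- The measure `w dx` on `(0, T)`. -/
def densityMeasure (T : ℝ) (w : ℝ → ℝ) : SignedMeasure ℝ := (leb T).withDensityᵥ w

/-- `TGV(u) = inf { α ‖Du - w‖_M + β ‖Dw‖_M | w ∈ BV(0, T) }`
(it is `⊤` when `u` is not in `BV(0, T)`). -/
def tgv (α β T : ℝ) (u : ℝ → ℝ) : EReal :=
  ⨅ (w : ℝ → ℝ) (μ : SignedMeasure ℝ) (ν : SignedMeasure ℝ)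
    (_ : IsDistribDeriv T u μ) (_ : IsDistribDeriv T w ν),
    ((α * radonNorm (μ - densityMeasure T w) + β * radonNorm ν : ℝ) : EReal)

/-- The objective `J(u) = f(u) + TGV(u)`. -/
def objective (α β T : ℝ) (f : L2 T → ℝ) (u : L2 T) : EReal := (f u : EReal) + tgv α β T u

/-- `ū ∈ BV(0, T)` minimizes `J` over `BV(0, T)`. In one dimension every function of `BV(0, T)` is
essentially bounded, so that `BV(0, T)` is a subset of `L²(0, T)`, on which `f` is defined. -/
def IsMinimizer (α β T : ℝ) (f : L2 T → ℝ) (ū : L2 T) : Prop :=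
  MemBV T ū ∧ ∀ u : L2 T, MemBV T u → objective α β T f ū ≤ objective α β T f u

/-- The dual variable `p(x) = ∫₀ˣ ∇f(u)`. -/
def dualp (T : ℝ) (f : L2 T → ℝ) (u : L2 T) (x : ℝ) : ℝ := ∫ t in (0 : ℝ)..x, (∇ f u : L2 T) t

/-- The dual variable `P(x) = - ∫₀ˣ p`. -/
def dualP (T : ℝ) (f : L2 T → ℝ) (u : L2 T) (x : ℝ) : ℝ := - ∫ t in (0 : ℝ)..x, dualp T f u t

/-- The jump function `S_{x₀} = 1_{(x₀, T)}`. -/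
def jump (T x₀ : ℝ) : ℝ → ℝ := (Ioo x₀ T).indicator fun _ => 1

/-- The kink function `K_{x₁}`: it is `1_{(0, x₁)} (x₁ - x)` for `x₁ < T/2` and
`1_{(x₁, T)} (x - x₁)` for `x₁ ≥ T/2`. -/
def kink (T x₁ : ℝ) : ℝ → ℝ :=
  if x₁ < T / 2 then (Ioo 0 x₁).indicator fun x => x₁ - x
  else (Ioo x₁ T).indicator fun x => x - x₁

/-- The derivative `DK_{x₁}`: it is `S_{x₁} - 1 = - 1_{(0, x₁]}` for `x₁ < T/2` and
`S_{x₁}` for `x₁ ≥ T/2`. -/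
def kinkDeriv (T x₁ : ℝ) (x : ℝ) : ℝ := jump T x₁ x - if x₁ < T / 2 then 1 else 0

/-- The function `(1/α) ∑ σˢⱼ λˢⱼ S_{xˢⱼ} + (1/β) ∑ σᴷⱼ λᴷⱼ K_{xᴷⱼ} + a x + b`. -/
def sparseFun (α β T : ℝ) {m n : ℕ} (xS : Fin m → ℝ) (xK : Fin n → ℝ)
    (sS : Fin m → ℝ) (sK : Fin n → ℝ) (lS : Fin m → ℝ) (lK : Fin n → ℝ) (a b : ℝ) (x : ℝ) : ℝ :=
  (1 / α) * ∑ j, sS j * lS j * jump T (xS j) x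
    + (1 / β) * ∑ j, sK j * lK j * kink T (xK j) x + a * x + b

theorem memLp_of_continuous (T : ℝ) {g : ℝ → ℝ} (hg : Continuous g) : MemLp g 2 (leb T) := by
  obtain ⟨C, hC⟩ := (isCompact_Icc (a := (0 : ℝ)) (b := T)).exists_bound_of_continuousOn
    hg.continuousOn
  refine MemLp.of_bound hg.aestronglyMeasurable C ?_
  filter_upwards [ae_restrict_mem measurableSet_Ioo] with x hx
  exact hC x (Ioo_subset_Icc_self hx)

theorem memLp_jump (T x₀ : ℝ) : MemLp (jump T x₀) 2 (leb T) :=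
  (memLp_of_continuous T continuous_const).indicator measurableSet_Ioo

theorem memLp_kink (T x₁ : ℝ) : MemLp (kink T x₁) 2 (leb T) := by
  unfold kink
  split_ifs
  · exact (memLp_of_continuous T (by fun_prop)).indicator measurableSet_Ioo
  · exact (memLp_of_continuous T (by fun_prop)).indicator measurableSet_Ioo

theorem memLp_sparseFun (α β T : ℝ) {m n : ℕ} (xS : Fin m → ℝ) (xK : Fin n → ℝ)
    (sS : Fin m → ℝ) (sK : Fin n → ℝ) (lS : Fin m → ℝ) (lK : Fin n → ℝ) (a b : ℝ) :
    MemLp (sparseFun α β T xS xK sS sK lS lK a b) 2 (leb T) := by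
  have h1 : MemLp (fun x => ∑ j, sS j * lS j * jump T (xS j) x) 2 (leb T) :=
    memLp_finsetSum _ fun j _ => (memLp_jump T (xS j)).const_mul _
  have h2 : MemLp (fun x => ∑ j, sK j * lK j * kink T (xK j) x) 2 (leb T) :=
    memLp_finsetSum _ fun j _ => (memLp_kink T (xK j)).const_mul _
  have h3 : MemLp (fun x : ℝ => a * x) 2 (leb T) := memLp_of_continuous T (by fun_prop)
  have h4 : MemLp (fun _ : ℝ => b) 2 (leb T) := memLp_of_continuous T continuous_const
  exact (((h1.const_mul _).add (h2.const_mul _)).add h3).add h4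

/-- `sparseFun` as an element of `L²(0, T)`. -/
def sparse (α β T : ℝ) {m n : ℕ} (xS : Fin m → ℝ) (xK : Fin n → ℝ)
    (sS : Fin m → ℝ) (sK : Fin n → ℝ) (lS : Fin m → ℝ) (lK : Fin n → ℝ) (a b : ℝ) : L2 T :=
  (memLp_sparseFun α β T xS xK sS sK lS lK a b).toLp _

end TGV1D

end

noncomputable section

namespace TGV1D


/-! The proof is by duality and needs no convexity of `f`. Write g = ∇f(ū), p for the primitive of g
and P for minus the primitive of p.

The functional `tgvValue` is sublinear, so moving from ū to ū + tv raises TGV by at most t times the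
cost of v. Differentiating at t = 0 gives 0 ≤ ⟨g, v⟩ + cost(v) for every v
(`IsMinimizer.nonneg_integral_gradient_add`). The direction -ū, along which TGV decreases linearly,
gives TGV(ū) ≤ -⟨g, ū⟩ (`IsMinimizer.tgvValue_le_neg_integral`).

Testing the first inequality with 1, x, jumps and kinks yields ∫g = 0, ∫p = 0, |p| ≤ α and |P| ≤ β
on (0, T). Integrating by parts twice, -⟨g, ū⟩ = ∫ p d(Dū - w) + ∫ P dDw, where the two terms are at
most α‖Dū - w‖ and β‖Dw‖. The second inequality forces equality in both, so Dū - w is carried by {p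
= ±α} and Dw by {P = ±β}, with matching signs (`exists_eq_sum_dirac`). These sets being finite, both
measures are sums of Dirac masses. Integrating recovers w up to the constant a, then ū up to the
constant b.

For the finite-dimensional problem, ∑λ bounds TGV of every admissible sparse function, with equality
at ū. -/

/-! ### Signed measures and the Radon norm. -/

instance isFiniteMeasure_variation (μ : SignedMeasure ℝ) : IsFiniteMeasure μ.variation := by
  rw [← SignedMeasure.totalVariation_eq_variation]
  unfold SignedMeasure.totalVariation
  infer_instance

theorem exists_jordan (μ : SignedMeasure ℝ) :
    ∃ (p n : Measure ℝ) (_ : IsFiniteMeasure p) (_ : IsFiniteMeasure n),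
      μ = p.toSignedMeasure - n.toSignedMeasure ∧ μ.variation = p + n :=
  ⟨_, _, inferInstance, inferInstance, (μ.toSignedMeasure_toJordanDecomposition).symm,
    (SignedMeasure.totalVariation_eq_variation μ).symm⟩

theorem integrable_of_continuous_of_bound {m : Measure ℝ} [IsFiniteMeasure m] {h : ℝ → ℝ}
    (hh : Continuous h) {C : ℝ} (hC : ∀ x, |h x| ≤ C) : Integrable h m :=
  Integrable.of_bound hh.aestronglyMeasurable C (Filter.Eventually.of_forall hC)

theorem signedIntegral_sub {h : ℝ → ℝ} {p n : Measure ℝ} [IsFiniteMeasure p] [IsFiniteMeasure n]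
    (hp : Integrable h p) (hn : Integrable h n) :
    ∫ᵛ x, h x ∂<•(p.toSignedMeasure - n.toSignedMeasure) = ∫ x, h x ∂p - ∫ x, h x ∂n := by
  rw [VectorMeasure.integral_sub_vectorMeasure]
  · simp
  · simpa [VectorMeasure.Integrable] using hp
  · simpa [VectorMeasure.Integrable] using hn

theorem radonNorm_add_le (μ ν : SignedMeasure ℝ) :
    radonNorm (μ + ν) ≤ radonNorm μ + radonNorm ν := by
  unfold radonNorm
  rw [← ENNReal.toReal_add (measure_ne_top _ _) (measure_ne_top _ _)]
  refine ENNReal.toReal_mono (by finiteness) ?_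
  exact VectorMeasure.variation_add_le univ

theorem radonNorm_smul (c : ℝ) (μ : SignedMeasure ℝ) :
    radonNorm (c • μ) = |c| * radonNorm μ := by
  unfold radonNorm
  have h : (c • μ).variation univ = (‖c‖₊ : ENNReal) * μ.variation univ := by
    rw [VectorMeasure.variation_smul]
    exact Measure.nnreal_smul_coe_apply _ _ _
  rw [h, ENNReal.toReal_mul]
  rfl

theorem radonNorm_zero : radonNorm 0 = 0 := by
  simp [radonNorm]

theorem radonNorm_dirac (x v : ℝ) : radonNorm (VectorMeasure.dirac x v) = |v| := by
  rw [radonNorm, VectorMeasure.variation_dirac, Measure.smul_apply, measure_univ, smul_eq_mul,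
    mul_one, toReal_enorm, Real.norm_eq_abs]

theorem radonNorm_sum_le {ι : Type*} (s : Finset ι) (μ : ι → SignedMeasure ℝ) :
    radonNorm (∑ i ∈ s, μ i) ≤ ∑ i ∈ s, radonNorm (μ i) := by
  classical
  induction s using Finset.induction_on with
  | empty => simp [radonNorm_zero]
  | insert i s hi ih =>
    rw [Finset.sum_insert hi, Finset.sum_insert hi]
    exact (radonNorm_add_le _ _).trans (by gcongr)

/-! ### Primitives, distribution functions and integration by parts. -/

/-- The primitive `y ↦ ∫_{(0, T) ∩ (-∞, y]} g`. -/
def cumul (T : ℝ) (g : ℝ → ℝ) (y : ℝ) : ℝ := ∫ x in Iic y, g x ∂(leb T)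

/-- The left-continuous distribution function of a signed measure. -/
def prim (μ : SignedMeasure ℝ) (x : ℝ) : ℝ := μ (Iio x)

theorem continuous_cumul {T : ℝ} {g : ℝ → ℝ} (hg : Integrable g (leb T)) :
    Continuous (cumul T g) := by
  have h : Integrable ((Ioo 0 T).indicator g) volume :=
    (integrable_indicator_iff measurableSet_Ioo).2 hg
  have key : ∀ y, cumul T g y
      = (∫ x in Iic (0 : ℝ), (Ioo 0 T).indicator g x)
        + ∫ x in (0 : ℝ)..y, (Ioo 0 T).indicator g x := by
    intro y
    rw [← intervalIntegral.integral_Iic_sub_Iic h.integrableOn h.integrableOn]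
    simp only [cumul, add_sub_cancel]
    rw [setIntegral_indicator measurableSet_Ioo, Measure.restrict_restrict measurableSet_Iic]
  rw [funext key]
  exact continuous_const.add
    (intervalIntegral.continuous_primitive (fun a b => h.intervalIntegrable) 0)

theorem abs_cumul_le {T : ℝ} {g : ℝ → ℝ} (hg : Integrable g (leb T)) (y : ℝ) :
    |cumul T g y| ≤ ∫ x, |g x| ∂(leb T) :=
  (abs_integral_le_integral_abs).trans
    (setIntegral_le_integral hg.abs (Filter.Eventually.of_forall fun _ => abs_nonneg _))

theorem integrable_cumul {T : ℝ} {g : ℝ → ℝ} (hg : Integrable g (leb T)) (m : Measure ℝ)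
    [IsFiniteMeasure m] : Integrable (cumul T g) m :=
  integrable_of_continuous_of_bound (continuous_cumul hg) (abs_cumul_le hg)

theorem prim_eq_sub (p n : Measure ℝ) [IsFiniteMeasure p] [IsFiniteMeasure n] (x : ℝ) :
    prim (p.toSignedMeasure - n.toSignedMeasure) x = p.real (Iio x) - n.real (Iio x) :=
  Measure.toSignedMeasure_sub_apply measurableSet_Iio

theorem measurable_real_Iio (m : Measure ℝ) [IsFiniteMeasure m] :
    Measurable fun x => m.real (Iio x) :=
  Monotone.measurable fun _ _ h => measureReal_mono (Iio_subset_Iio h)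

theorem measurable_prim (μ : SignedMeasure ℝ) : Measurable (prim μ) := by
  obtain ⟨p, n, _, _, rfl, -⟩ := exists_jordan μ
  rw [funext (prim_eq_sub p n)]
  exact (measurable_real_Iio p).sub (measurable_real_Iio n)

theorem abs_prim_le (μ : SignedMeasure ℝ) (x : ℝ) : |prim μ x| ≤ radonNorm μ :=
  (VectorMeasure.norm_measure_le_variation (μ := μ) (E := Iio x) (measure_ne_top _ _)).trans
    (measureReal_mono (μ := μ.variation) (subset_univ _))

theorem integrable_prim (T : ℝ) (μ : SignedMeasure ℝ) : Integrable (prim μ) (leb T) :=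
  Integrable.of_bound (measurable_prim μ).aestronglyMeasurable _
    (Filter.Eventually.of_forall (abs_prim_le μ))

/-- Fubini for the kernel g(x) 1_{y < x}. -/
theorem integral_mul_real_Iio {T : ℝ} {g : ℝ → ℝ} (hg : Integrable g (leb T))
    (m : Measure ℝ) [IsFiniteMeasure m] :
    ∫ x, g x * m.real (Iio x) ∂(leb T) = ∫ y, (∫ x in Ioi y, g x ∂(leb T)) ∂m := by
  have h1 : ∀ x, g x * m.real (Iio x) = ∫ y, (if y < x then g x else 0) ∂m := by
    intro x
    have : (fun y => if y < x then g x else 0) = (Iio x).indicator fun _ => g x := by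
      ext y; simp [indicator]
    rw [this, integral_indicator measurableSet_Iio, setIntegral_const, smul_eq_mul, mul_comm]
  have h2 : ∀ y, (∫ x in Ioi y, g x ∂(leb T)) = ∫ x, (if y < x then g x else 0) ∂(leb T) := by
    intro y
    rw [← integral_indicator measurableSet_Ioi]
    rfl
  simp_rw [h1, h2]
  refine integral_integral_swap ?_
  have h3 : Integrable (fun z : ℝ × ℝ => g z.1) ((leb T).prod m) := hg.comp_fst m
  refine (h3.indicator (measurableSet_lt measurable_snd measurable_fst)).congr ?_
  exact Filter.Eventually.of_forall fun z => by simp [indicator, Function.uncurry]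

/-- Integration by parts: the zero mean of g turns its integral over (y, ∞) into -`cumul T g y`, so
no boundary term remains. -/
theorem integral_mul_prim {T : ℝ} {g : ℝ → ℝ} (hg : Integrable g (leb T))
    (h0 : ∫ x, g x ∂(leb T) = 0) (μ : SignedMeasure ℝ) :
    ∫ x, g x * prim μ x ∂(leb T) = - ∫ᵛ y, cumul T g y ∂<•μ := by
  obtain ⟨p, n, _, _, rfl, -⟩ := exists_jordan μ
  have hI : ∀ y, (∫ x in Ioi y, g x ∂(leb T)) = - cumul T g y := by
    intro y
    have := integral_add_compl (measurableSet_Iic (a := y)) hg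
    rw [compl_Iic, h0] at this
    simp only [cumul]; linarith
  have hb : ∀ m : Measure ℝ, IsFiniteMeasure m →
      Integrable (fun x => g x * m.real (Iio x)) (leb T) := fun m _ =>
    hg.mul_bdd (c := m.real univ) (measurable_real_Iio m).aestronglyMeasurable
      (Filter.Eventually.of_forall fun x => by
        rw [Real.norm_of_nonneg measureReal_nonneg]; exact measureReal_mono (subset_univ _))
  rw [signedIntegral_sub (integrable_cumul hg p) (integrable_cumul hg n)]
  simp_rw [prim_eq_sub, mul_sub]
  rw [integral_sub (hb p inferInstance) (hb n inferInstance), integral_mul_real_Iio hg,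
    integral_mul_real_Iio hg]
  simp_rw [hI, integral_neg]
  ring

theorem signedIntegral_densityMeasure {T : ℝ} {w h : ℝ → ℝ} (hw : Integrable w (leb T))
    (hh : Continuous h) {C : ℝ} (hC : ∀ x, |h x| ≤ C) :
    ∫ᵛ x, h x ∂<•(densityMeasure T w) = ∫ x, h x * w x ∂(leb T) := by
  -- The densities of the positive and negative parts must be measurable, hence the passage to a
  -- measurable representative.
  have hae := hw.aestronglyMeasurable.ae_eq_mk
  set w' := hw.aestronglyMeasurable.mk w with hw'
  have hm : Measurable w' := hw.aestronglyMeasurable.stronglyMeasurable_mk.measurable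
  have hwi : Integrable w' (leb T) := hw.congr hae
  have e1 : densityMeasure T w = densityMeasure T w' := WithDensityᵥEq.congr_ae hae
  have e2 : ∫ x, h x * w x ∂(leb T) = ∫ x, h x * w' x ∂(leb T) :=
    integral_congr_ae (by filter_upwards [hae] with x hx; rw [hx])
  rw [e1, e2, densityMeasure, withDensityᵥ_eq_withDensity_pos_part_sub_withDensity_neg_part hwi]
  have f1 := isFiniteMeasure_withDensity_ofReal hwi.2
  have f2 := isFiniteMeasure_withDensity_ofReal hwi.neg.2
  simp only [Pi.neg_apply] at f2
  rw [signedIntegral_sub (integrable_of_continuous_of_bound hh hC)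
    (integrable_of_continuous_of_bound hh hC),
    integral_withDensity_eq_integral_toReal_smul (by fun_prop) (by simp),
    integral_withDensity_eq_integral_toReal_smul (by fun_prop) (by simp), ← integral_sub]
  · refine integral_congr_ae (Filter.Eventually.of_forall fun x => ?_)
    simp only [ENNReal.toReal_ofReal', smul_eq_mul]
    rcases le_total 0 (w' x) with h | h
    · rw [max_eq_left h, max_eq_right (by linarith)]; ring
    · rw [max_eq_right h, max_eq_left (by linarith)]; ring
  · simp only [ENNReal.toReal_ofReal', smul_eq_mul]
    exact hwi.pos_part.mul_bdd hh.aestronglyMeasurable (Filter.Eventually.of_forall hC)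
  · simp only [ENNReal.toReal_ofReal', smul_eq_mul]
    exact hwi.neg.pos_part.mul_bdd hh.aestronglyMeasurable (Filter.Eventually.of_forall hC)


/-! ### Test functions and the calculus of distributional derivatives. -/

namespace IsTest

variable {T : ℝ} {φ : ℝ → ℝ}

theorem exists_bound (hφ : IsTest T φ) : ∃ C, ∀ x, |φ x| ≤ C :=
  hφ.compact.exists_bound_of_continuous hφ.smooth.continuous

theorem continuous_deriv (hφ : IsTest T φ) : Continuous (deriv φ) :=
  hφ.smooth.continuous_deriv (by simp)

theorem exists_bound_deriv (hφ : IsTest T φ) : ∃ C, ∀ x, |deriv φ x| ≤ C :=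
  hφ.compact.deriv.exists_bound_of_continuous hφ.continuous_deriv

theorem integrable_deriv (hφ : IsTest T φ) : Integrable (deriv φ) (leb T) :=
  hφ.exists_bound_deriv.elim fun _ hC => integrable_of_continuous_of_bound hφ.continuous_deriv hC

theorem integrable_mul_deriv (hφ : IsTest T φ) {u : ℝ → ℝ} (hu : Integrable u (leb T)) :
    Integrable (fun x => u x * deriv φ x) (leb T) :=
  hφ.exists_bound_deriv.elim fun _ hC =>
    hu.mul_bdd hφ.continuous_deriv.aestronglyMeasurable (Filter.Eventually.of_forall hC)

theorem integrable_signed (hφ : IsTest T φ) (μ : SignedMeasure ℝ) : μ.Integrable φ :=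
  hφ.exists_bound.elim fun _ hC => integrable_of_continuous_of_bound hφ.smooth.continuous hC

theorem cumul_deriv (hφ : IsTest T φ) (y : ℝ) : cumul T (deriv φ) y = φ y := by
  rw [← hφ.compact.integral_Iic_deriv_eq (hφ.smooth.of_le (by simp)) y, cumul,
    Measure.restrict_restrict measurableSet_Iic]
  refine (setIntegral_eq_of_subset_of_forall_sdiff_eq_zero measurableSet_Iic inter_subset_left
    fun x hx => ?_).symm
  by_contra h
  exact hx.2 ⟨hx.1, hφ.support (support_deriv_subset h)⟩

theorem integral_deriv (hφ : IsTest T φ) : ∫ x, deriv φ x ∂(leb T) = 0 := by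
  -- At y = T the primitive is the whole integral, while φ(T) = 0 because T lies outside the
  -- support.
  have h := hφ.cumul_deriv T
  rw [cumul, Measure.restrict_restrict measurableSet_Iic,
    inter_eq_right.2 fun x hx => hx.2.le] at h
  rw [h]
  by_contra h'
  exact lt_irrefl T (hφ.support (subset_tsupport _ h')).2

end IsTest

/-- A test function is the `cumul` of its derivative, so this is `integral_mul_prim` with g = φ'.
The derivatives of jumps, kinks and x are obtained from it. -/
theorem isDistribDeriv_prim {T : ℝ} {μ : SignedMeasure ℝ} (hμ : μ.variation (Ioo 0 T)ᶜ = 0) :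
    IsDistribDeriv T (prim μ) μ where
  integrable := integrable_prim T μ
  concentrated := hμ
  integral_eq φ hφ := by
    have h := integral_mul_prim hφ.integrable_deriv hφ.integral_deriv μ
    simp_rw [hφ.cumul_deriv] at h
    rw [← h]
    simp_rw [mul_comm]

namespace IsDistribDeriv

variable {T : ℝ} {u v : ℝ → ℝ} {μ ν : SignedMeasure ℝ}

theorem congr (h : IsDistribDeriv T u μ) (huv : u =ᵐ[leb T] v) : IsDistribDeriv T v μ where
  integrable := Integrable.congr h.integrable huv
  concentrated := h.concentrated
  integral_eq φ hφ := by
    rw [← h.integral_eq φ hφ]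
    exact integral_congr_ae (by filter_upwards [huv] with x hx; rw [hx])

theorem add (hu : IsDistribDeriv T u μ) (hv : IsDistribDeriv T v ν) :
    IsDistribDeriv T (fun x => u x + v x) (μ + ν) where
  integrable := Integrable.add hu.integrable hv.integrable
  concentrated := by
    refine le_antisymm ((VectorMeasure.variation_add_le _).trans ?_) bot_le
    rw [Measure.add_apply, hu.concentrated, hv.concentrated, add_zero]
  integral_eq φ hφ := by
    simp_rw [add_mul]
    rw [integral_add (hφ.integrable_mul_deriv hu.integrable)
      (hφ.integrable_mul_deriv hv.integrable), hu.integral_eq φ hφ, hv.integral_eq φ hφ,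
      VectorMeasure.integral_add_vectorMeasure (hφ.integrable_signed μ) (hφ.integrable_signed ν)]
    ring

theorem const_mul (c : ℝ) (hu : IsDistribDeriv T u μ) :
    IsDistribDeriv T (fun x => c * u x) (c • μ) where
  integrable := Integrable.const_mul hu.integrable c
  concentrated := by
    have h : (c • μ).variation (Ioo 0 T)ᶜ = (‖c‖₊ : ENNReal) * μ.variation (Ioo 0 T)ᶜ := by
      rw [VectorMeasure.variation_smul]
      exact Measure.nnreal_smul_coe_apply _ _ _
    rw [h, hu.concentrated, mul_zero]
  integral_eq φ hφ := by
    simp_rw [mul_assoc]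
    rw [integral_const_mul, hu.integral_eq φ hφ, VectorMeasure.integral_smul_vectorMeasure,
      smul_eq_mul]
    ring

theorem const (c : ℝ) : IsDistribDeriv T (fun _ => c) 0 where
  integrable := integrable_const (μ := leb T) c
  concentrated := by simp
  integral_eq φ hφ := by
    rw [integral_const_mul, hφ.integral_deriv]
    simp

theorem sum {ι : Type*} (s : Finset ι) {u : ι → ℝ → ℝ} {μ : ι → SignedMeasure ℝ}
    (h : ∀ i ∈ s, IsDistribDeriv T (u i) (μ i)) :
    IsDistribDeriv T (fun x => ∑ i ∈ s, u i x) (∑ i ∈ s, μ i) := by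
  classical
  induction s using Finset.induction_on with
  | empty => simpa using const 0
  | insert i s hi ih =>
    simp_rw [Finset.sum_insert hi]
    exact (h i (Finset.mem_insert_self i s)).add
      (ih fun j hj => h j (Finset.mem_insert_of_mem hj))

end IsDistribDeriv

/-! ### A measure determines its primitive up to a constant. -/

theorem exists_Icc_subset_Ioo {T : ℝ} (hT : 0 < T) {K : Set ℝ} (hK : IsCompact K)
    (hKT : K ⊆ Ioo 0 T) : ∃ a b, 0 < a ∧ b < T ∧ K ⊆ Icc a b := by
  rcases K.eq_empty_or_nonempty with rfl | hne
  · exact ⟨T / 2, T / 2, by linarith, by linarith, empty_subset _⟩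
  · obtain ⟨a, ha⟩ := hK.exists_isLeast hne
    obtain ⟨b, hb⟩ := hK.exists_isGreatest hne
    exact ⟨a, b, (hKT ha.1).1, (hKT hb.1).2, fun x hx => ⟨ha.2 hx, hb.2 hx⟩⟩

/-- The primitive vanishes to the left of the support of h, and to its right because h has zero
mean. -/
theorem exists_isTest_deriv_eq {T : ℝ} (hT : 0 < T) {h : ℝ → ℝ} (hh : IsTest T h)
    (h0 : ∫ x, h x = 0) : ∃ φ, IsTest T φ ∧ deriv φ = h := by
  obtain ⟨a, b, ha, hb, hab⟩ := exists_Icc_subset_Ioo hT hh.compact hh.support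
  have hd : ∀ x, HasDerivAt (fun y => ∫ t in (0 : ℝ)..y, h t) (h x) x := fun x =>
    hh.smooth.continuous.integral_hasStrictDerivAt 0 x |>.hasDerivAt
  have hderiv : deriv (fun y => ∫ t in (0 : ℝ)..y, h t) = h := funext fun x => (hd x).deriv
  have hz : ∀ x, x ∉ Icc a b → h x = 0 := fun x hx =>
    by_contra fun hne => hx (hab (subset_tsupport _ hne))
  have hsupp : tsupport (fun y => ∫ t in (0 : ℝ)..y, h t) ⊆ Icc a b := by
    refine closure_minimal (fun x hx => ?_) isClosed_Icc
    by_contra hxab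
    refine hx ?_
    rcases lt_or_ge x a with hxa | hxa
    · have : ∫ t in (0 : ℝ)..x, h t = ∫ t in (0 : ℝ)..x, (0 : ℝ) := by
        refine intervalIntegral.integral_congr fun t ht => hz t fun ht' => ?_
        have := ht.2
        have := ht'.1
        rcases le_total 0 x with h' | h'
        · rw [max_eq_right h'] at *; linarith
        · rw [max_eq_left h'] at *; linarith
      simpa using this
    · have hxb : b < x := by
        by_contra hbx
        exact hxab ⟨hxa, not_lt.1 hbx⟩
      refine (intervalIntegral.integral_eq_integral_of_support_subset fun t ht => ?_).trans h0
      have := hab (subset_tsupport _ ht)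
      exact ⟨ha.trans_le this.1, this.2.trans hxb.le⟩
  refine ⟨_, ⟨?_, isCompact_Icc.of_isClosed_subset (isClosed_tsupport _) hsupp,
    hsupp.trans fun x hx => ⟨ha.trans_le hx.1, hx.2.trans_lt hb⟩⟩, hderiv⟩
  rw [contDiff_infty_iff_deriv, hderiv]
  exact ⟨fun x => (hd x).differentiableAt, hh.smooth⟩

theorem exists_isTest_integral_eq_one {T : ℝ} (hT : 0 < T) :
    ∃ ψ, IsTest T ψ ∧ ∫ x, ψ x = 1 := by
  obtain ⟨f, hf1, hf2, hf3, hf4, hf5⟩ := exists_contDiff_tsupport_subset (n := ⊤)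
    (Ioo_mem_nhds (half_pos hT) (half_lt_self hT))
  have hpos : 0 < ∫ x, f x :=
    hf3.continuous.integral_pos_of_hasCompactSupport_nonneg_nonzero hf2
      (fun x => (hf4 (mem_range_self x)).1) (x := T / 2) (by rw [hf5]; exact one_ne_zero)
  refine ⟨fun x => (∫ x, f x)⁻¹ * f x, ⟨contDiff_const.mul hf3, hf2.mul_left,
    (tsupport_mul_subset_right).trans hf1⟩, ?_⟩
  rw [integral_const_mul, inv_mul_cancel₀ hpos.ne']

/-- The lemma of du Bois-Reymond. -/
theorem ae_eq_const_of_integral_mul_deriv_eq_zero {T : ℝ} (hT : 0 < T) {v : ℝ → ℝ}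
    (hv : Integrable v (leb T))
    (h : ∀ φ, IsTest T φ → ∫ x, v x * deriv φ x ∂(leb T) = 0) :
    ∃ c, ∀ᵐ x ∂(leb T), v x = c := by
  obtain ⟨ψ, hψ, hψ1⟩ := exists_isTest_integral_eq_one hT
  have hint : ∀ g, IsTest T g → Integrable (fun x => v x * g x) (leb T) := fun g hg =>
    hg.exists_bound.elim fun _ hC =>
      hv.mul_bdd hg.smooth.continuous.aestronglyMeasurable (Filter.Eventually.of_forall hC)
  have hvol : ∀ g, IsTest T g → ∫ x, g x ∂(leb T) = ∫ x, g x := fun g hg =>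
    setIntegral_eq_integral_of_forall_compl_eq_zero fun x hx =>
      by_contra fun hne => hx (hg.support (subset_tsupport _ hne))
  set c := ∫ x, v x * ψ x ∂(leb T) with hc
  refine ⟨c, ?_⟩
  have key := isOpen_Ioo.ae_eq_zero_of_integral_contDiff_smul_eq_zero (U := Ioo 0 T)
    (μ := volume) (f := fun x => v x - c)
    (IntegrableOn.locallyIntegrableOn (hv.sub (integrable_const c))) ?_
  · rw [ae_restrict_iff' measurableSet_Ioo]
    filter_upwards [key] with x hx hxT
    linarith [hx hxT]
  · intro g hg1 hg2 hg3
    have hg : IsTest T g := ⟨hg1, hg2, hg3⟩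
    -- Subtracting this multiple of ψ makes the mean zero, so the result is the derivative of a test
    -- function. The correction is what produces the constant c = ∫ vψ.
    have hsm : IsTest T fun x => g x - (∫ x, g x) * ψ x := by
      refine ⟨hg1.sub (contDiff_const.mul hψ.smooth), hg2.sub hψ.compact.mul_left, ?_⟩
      refine (tsupport_sub _ _).trans (union_subset hg3 ?_)
      exact (tsupport_mul_subset_right).trans hψ.support
    have hcg : Integrable g volume := hg1.continuous.integrable_of_hasCompactSupport hg2
    have hcψ : Integrable ψ volume := hψ.smooth.continuous.integrable_of_hasCompactSupport hψ.compact
    obtain ⟨φ, hφ, hφd⟩ := exists_isTest_deriv_eq hT hsm (by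
      rw [integral_sub hcg (hcψ.const_mul _), integral_const_mul, hψ1]; ring)
    have h1 := h φ hφ
    rw [hφd] at h1
    have h2 : ∫ x, v x * (g x - (∫ x, g x) * ψ x) ∂(leb T)
        = ∫ x, v x * g x ∂(leb T) - (∫ x, g x) * c := by
      rw [hc, ← integral_const_mul, ← integral_sub (hint g hg) ((hint ψ hψ).const_mul _)]
      congr 1; ext x; ring
    have h3 : ∫ x, g x • (v x - c) = ∫ x, g x • (v x - c) ∂(leb T) :=
      (setIntegral_eq_integral_of_forall_compl_eq_zero fun x hx => by
        rw [by_contra fun hne => hx (hg3 (subset_tsupport _ hne)), zero_smul]).symm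
    have h4 : ∫ x, g x • (v x - c) ∂(leb T) = ∫ x, v x * g x ∂(leb T) - (∫ x, g x) * c := by
      rw [← hvol g hg, ← integral_mul_const,
        ← integral_sub (hint g hg) (hcg.restrict.mul_const _)]
      congr 1; ext x; simp only [smul_eq_mul]; ring
    rw [h3, h4, ← h2, h1]

namespace IsDistribDeriv

variable {T : ℝ} {u v : ℝ → ℝ} {μ ν : SignedMeasure ℝ}

theorem exists_ae_eq_add_const (hT : 0 < T) (hu : IsDistribDeriv T u μ)
    (hv : IsDistribDeriv T v μ) : ∃ c, ∀ᵐ x ∂(leb T), u x = v x + c := by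
  obtain ⟨c, hc⟩ := ae_eq_const_of_integral_mul_deriv_eq_zero hT
    (Integrable.sub hu.integrable hv.integrable) fun φ hφ => by
      simp_rw [Pi.sub_apply, sub_mul]
      rw [integral_sub (hφ.integrable_mul_deriv hu.integrable)
        (hφ.integrable_mul_deriv hv.integrable), hu.integral_eq φ hφ, hv.integral_eq φ hφ, sub_self]
  refine ⟨c, hc.mono fun x hx => ?_⟩
  simp only [Pi.sub_apply] at hx
  linarith

/-- Since u is `prim μ` plus a constant, and the constant pairs to zero with g, integration by parts
extends from test functions to zero-mean integrable g. -/
theorem integral_mul_eq (hT : 0 < T) (hu : IsDistribDeriv T u μ) {g : ℝ → ℝ}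
    (hg : Integrable g (leb T)) (h0 : ∫ x, g x ∂(leb T) = 0) :
    ∫ x, g x * u x ∂(leb T) = - ∫ᵛ y, cumul T g y ∂<•μ := by
  obtain ⟨c, hc⟩ := hu.exists_ae_eq_add_const hT (isDistribDeriv_prim hu.concentrated)
  have h1 : ∫ x, g x * u x ∂(leb T) = ∫ x, (g x * prim μ x + g x * c) ∂(leb T) :=
    integral_congr_ae (by filter_upwards [hc] with x hx; rw [hx]; ring)
  rw [h1, integral_add, integral_mul_prim hg h0, integral_mul_const, h0]
  · ring
  · exact hg.mul_bdd (measurable_prim μ).aestronglyMeasurable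
      (Filter.Eventually.of_forall (abs_prim_le μ))
  · exact hg.mul_const c

end IsDistribDeriv

/-! ### Derivatives of jumps, kinks and the identity. -/

theorem isDistribDeriv_jump {T x₀ : ℝ} (hx₀ : x₀ ∈ Ioo 0 T) :
    IsDistribDeriv T (jump T x₀) (VectorMeasure.dirac x₀ 1) := by
  refine (isDistribDeriv_prim ?_).congr ?_
  · rw [VectorMeasure.variation_dirac, Measure.smul_apply,
      Measure.dirac_apply' _ measurableSet_Ioo.compl]
    simp [hx₀.1, hx₀.2]
  · filter_upwards [ae_restrict_mem measurableSet_Ioo] with x hx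
    by_cases h : x₀ < x
    · rw [prim, VectorMeasure.dirac_apply_of_mem measurableSet_Iio h, jump,
        indicator_of_mem (show x ∈ Ioo x₀ T from ⟨h, hx.2⟩)]
    · rw [prim, VectorMeasure.dirac_apply_of_notMem (show x₀ ∉ Iio x from h), jump,
        indicator_of_notMem fun h' => h h'.1]

theorem isDistribDeriv_prim_densityMeasure {T : ℝ} {w : ℝ → ℝ} (hw : Integrable w (leb T)) :
    IsDistribDeriv T (fun x => ∫ t in Iio x, w t ∂(leb T)) (densityMeasure T w) := by
  refine (isDistribDeriv_prim ?_).congr (Filter.Eventually.of_forall fun x => ?_)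
  · rw [densityMeasure, Measure.variation_withDensityᵥ hw]
    refine withDensity_absolutelyContinuous _ _ ?_
    rw [Measure.restrict_apply measurableSet_Ioo.compl, compl_inter_self, measure_empty]
  · exact withDensityᵥ_apply hw measurableSet_Iio

theorem isDistribDeriv_id {T : ℝ} : IsDistribDeriv T (fun x => x) (densityMeasure T fun _ => 1) := by
  refine (isDistribDeriv_prim_densityMeasure (integrable_const 1)).congr ?_
  filter_upwards [ae_restrict_mem measurableSet_Ioo] with x hx
  rw [Measure.restrict_restrict measurableSet_Iio, setIntegral_const,
    show Iio x ∩ Ioo 0 T = Ioo 0 x by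
      ext t; simp only [mem_inter_iff, mem_Iio, mem_Ioo]; have := hx.2; grind]
  simp [hx.1.le]

theorem isDistribDeriv_kinkDeriv {T x₁ : ℝ} (hx₁ : x₁ ∈ Ioo 0 T) :
    IsDistribDeriv T (kinkDeriv T x₁) (VectorMeasure.dirac x₁ 1) := by
  have h := (isDistribDeriv_jump hx₁).add
    (IsDistribDeriv.const (T := T) (-(if x₁ < T / 2 then 1 else 0)))
  rw [add_zero] at h
  exact h

theorem isDistribDeriv_kink {T x₁ : ℝ} (hx₁ : x₁ ∈ Ioo 0 T) :
    IsDistribDeriv T (kink T x₁) (densityMeasure T (kinkDeriv T x₁)) := by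
  have h := (isDistribDeriv_prim_densityMeasure (isDistribDeriv_kinkDeriv hx₁).integrable).add
    -- A left kink starts at height x₁: its derivative integrates to (x - x₁)⁺ - x, and adding x₁
    -- gives (x₁ - x)⁺.
    (IsDistribDeriv.const (T := T) (if x₁ < T / 2 then x₁ else 0))
  rw [add_zero] at h
  refine h.congr ?_
  filter_upwards [ae_restrict_mem measurableSet_Ioo] with x hx
  have e1 : Iio x ∩ Ioo 0 T = Ioo 0 x := by
    ext t; simp only [mem_inter_iff, mem_Iio, mem_Ioo]; have := hx.2; grind
  have e2 : Ioo 0 x ∩ Ioo x₁ T = Ioo x₁ x := by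
    ext t; simp only [mem_inter_iff, mem_Ioo]; have := hx.2; have := hx₁.1; grind
  have e3 : ∫ t in Iio x, kinkDeriv T x₁ t ∂(leb T)
      = max (x - x₁) 0 - x * (if x₁ < T / 2 then 1 else 0) := by
    rw [Measure.restrict_restrict measurableSet_Iio, e1]
    unfold kinkDeriv jump
    rw [integral_sub ((integrable_const _).indicator measurableSet_Ioo) (integrable_const _),
      setIntegral_indicator measurableSet_Ioo, e2, setIntegral_const, setIntegral_const]
    simp [Measure.real, ENNReal.toReal_ofReal', hx.1.le]
  rw [e3]
  unfold kink
  by_cases hT : x₁ < T / 2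
  · simp only [hT, if_true]
    by_cases h1 : x < x₁
    · rw [indicator_of_mem (show x ∈ Ioo 0 x₁ from ⟨hx.1, h1⟩), max_eq_right (by linarith)]; ring
    · rw [indicator_of_notMem fun h => h1 h.2, max_eq_left (by linarith)]; ring
  · simp only [hT, if_false]
    by_cases h1 : x₁ < x
    · rw [indicator_of_mem (show x ∈ Ioo x₁ T from ⟨h1, hx.2⟩), max_eq_left (by linarith)]; ring
    · rw [indicator_of_notMem fun h => h1 h.1, max_eq_right (by linarith)]; ring


/-! ### Density measures, and equality in the duality between measures and continuous functions. -/

theorem densityMeasure_zero (T : ℝ) : densityMeasure T (fun _ => 0) = 0 := withDensityᵥ_zero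

theorem densityMeasure_add {T : ℝ} {v w : ℝ → ℝ} (hv : Integrable v (leb T))
    (hw : Integrable w (leb T)) :
    densityMeasure T (fun x => v x + w x) = densityMeasure T v + densityMeasure T w :=
  withDensityᵥ_add' hv hw

theorem densityMeasure_const_mul {T : ℝ} (c : ℝ) (w : ℝ → ℝ) :
    densityMeasure T (fun x => c * w x) = c • densityMeasure T w :=
  withDensityᵥ_smul (𝕜 := ℝ) w c

theorem densityMeasure_sum {T : ℝ} {ι : Type*} (s : Finset ι) {w : ι → ℝ → ℝ}
    (hw : ∀ i ∈ s, Integrable (w i) (leb T)) :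
    densityMeasure T (fun x => ∑ i ∈ s, w i x) = ∑ i ∈ s, densityMeasure T (w i) := by
  classical
  induction s using Finset.induction_on with
  | empty => simpa using densityMeasure_zero T
  | insert i s hi ih =>
    simp_rw [Finset.sum_insert hi]
    rw [densityMeasure_add (hw i (Finset.mem_insert_self i s))
      (integrable_finsetSum _ fun j hj => hw j (Finset.mem_insert_of_mem hj)),
      ih fun j hj => hw j (Finset.mem_insert_of_mem hj)]

theorem tgv_le {α β T : ℝ} {u w : ℝ → ℝ} {μ ν : SignedMeasure ℝ} (hu : IsDistribDeriv T u μ)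
    (hw : IsDistribDeriv T w ν) :
    tgv α β T u ≤ ((α * radonNorm (μ - densityMeasure T w) + β * radonNorm ν : ℝ) : EReal) :=
  iInf_le_of_le w <| iInf_le_of_le μ <| iInf_le_of_le ν <| iInf_le_of_le hu <|
    iInf_le_of_le hw le_rfl

/-- Sums over the range of a finite family, with repetitions discarded. -/
theorem exists_forall_sum_ite_eq_sum_image {N : ℕ} (x : Fin N → ℝ) :
    ∃ P : Fin N → Prop, ∀ [DecidablePred P] (F : ℝ → ℝ),
      ∑ j, (if P j then F (x j) else 0) = ∑ y ∈ Finset.univ.image x, F y := by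
  -- The family need not be injective; P keeps the least index of each value.
  refine ⟨fun j => ∀ i, x i = x j → j ≤ i, fun F => ?_⟩
  rw [← Finset.sum_filter, ← Finset.sum_image (f := F) (g := x)]
  · congr 1
    refine (Finset.image_subset_image (Finset.filter_subset _ _)).antisymm fun y hy => ?_
    obtain ⟨j, -, rfl⟩ := Finset.mem_image.1 hy
    have hne : (Finset.univ.filter fun i => x i = x j).Nonempty := ⟨j, by simp⟩
    have hk := Finset.min'_mem _ hne
    simp only [Finset.mem_filter, Finset.mem_univ, true_and] at hk
    refine Finset.mem_image.2 ⟨_, ?_, hk⟩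
    simp only [Finset.mem_filter, Finset.mem_univ, true_and]
    exact fun i hi => Finset.min'_le _ _ (by simp [hi.trans hk])
  · intro i hi j hj hij
    simp only [Finset.coe_filter, Finset.mem_univ, true_and, mem_ofPred_eq] at hi hj
    exact le_antisymm (hi j hij.symm) (hj i hij)

theorem real_eq_sum_singleton {m : Measure ℝ} [IsFiniteMeasure m] {S : Finset ℝ}
    (hS : m (S : Set ℝ)ᶜ = 0) (A : Set ℝ) [DecidablePred (· ∈ A)] :
    m.real A = ∑ y ∈ S, if y ∈ A then m.real {y} else 0 := by
  rw [← Finset.sum_filter, sum_measureReal_singleton]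
  have : m A = m (A ∩ S) := (measure_inter_conull' (measure_mono_null (by
    intro y hy; exact hy.2) hS)).symm
  simp only [Measure.real, this]
  congr 2
  ext y
  simp [and_comm]

/-- The gap in the inequality `∫ h dμ ≤ α ‖μ‖`, in terms of a decomposition of `μ`. -/
theorem mul_radonNorm_sub_eq {p n : Measure ℝ} [IsFiniteMeasure p] [IsFiniteMeasure n]
    (hv : (p.toSignedMeasure - n.toSignedMeasure).variation = p + n) {h : ℝ → ℝ}
    (hh : Continuous h) {C : ℝ} (hC : ∀ x, |h x| ≤ C) (α : ℝ) :
    α * radonNorm (p.toSignedMeasure - n.toSignedMeasure)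
        - ∫ᵛ x, h x ∂<•(p.toSignedMeasure - n.toSignedMeasure)
      = ∫ x, (α - h x) ∂p + ∫ x, (α + h x) ∂n := by
  have hp : Integrable h p := integrable_of_continuous_of_bound hh hC
  have hn : Integrable h n := integrable_of_continuous_of_bound hh hC
  rw [signedIntegral_sub hp hn, radonNorm, hv, Measure.add_apply,
    ENNReal.toReal_add (measure_ne_top _ _) (measure_ne_top _ _),
    integral_sub (integrable_const _) hp, integral_add (integrable_const _) hn]
  simp [Measure.real]
  ring

/-- Both integrals in the gap formula `mul_radonNorm_sub_eq` have integrands that are nonnegative on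
(0, T), where the measures live. The global bound C serves only for integrability. -/
theorem signedIntegral_le_mul_radonNorm {T α : ℝ} {μ : SignedMeasure ℝ}
    (hμ : μ.variation (Ioo 0 T)ᶜ = 0) {h : ℝ → ℝ} (hh : Continuous h) {C : ℝ}
    (hC : ∀ x, |h x| ≤ C) (hα : ∀ x ∈ Ioo 0 T, |h x| ≤ α) :
    ∫ᵛ x, h x ∂<•μ ≤ α * radonNorm μ := by
  obtain ⟨p, n, _, _, rfl, hv⟩ := exists_jordan μ
  have e := mul_radonNorm_sub_eq hv hh hC α
  rw [hv, Measure.add_apply, add_eq_zero] at hμ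
  have hp : 0 ≤ ∫ x, (α - h x) ∂p := integral_nonneg_of_ae (by
    filter_upwards [compl_mem_ae_iff.2 hμ.1] with x hx
    have := hα x (not_not.1 hx)
    simp only [Pi.zero_apply]
    linarith [le_abs_self (h x)])
  have hn : 0 ≤ ∫ x, (α + h x) ∂n := integral_nonneg_of_ae (by
    filter_upwards [compl_mem_ae_iff.2 hμ.2] with x hx
    have := hα x (not_not.1 hx)
    simp only [Pi.zero_apply]
    linarith [neg_abs_le (h x)])
  linarith

/-- A measure `μ` with `∫ h dμ = α ‖μ‖`, where `|h| ≤ α`, is carried by `{h = ± α}`, with the sign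
of `h`. -/
theorem exists_eq_sum_dirac {T α : ℝ} (hα0 : 0 < α) {μ : SignedMeasure ℝ}
    (hμ : μ.variation (Ioo 0 T)ᶜ = 0) {h : ℝ → ℝ} (hh : Continuous h) {C : ℝ}
    (hC : ∀ x, |h x| ≤ C) (hα : ∀ x ∈ Ioo 0 T, |h x| ≤ α) {N : ℕ} {x : Fin N → ℝ}
    (hx : {y ∈ Ioo 0 T | h y = α ∨ h y = -α} = range x)
    (hle : α * radonNorm μ ≤ ∫ᵛ y, h y ∂<•μ) :
    ∃ c : Fin N → ℝ, (∀ j, 0 ≤ c j) ∧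
      μ = ∑ j, (h (x j) / α * c j) • VectorMeasure.dirac (x j) 1 ∧ radonNorm μ = ∑ j, c j := by
  classical
  obtain ⟨p, n, _, _, rfl, hv⟩ := exists_jordan μ
  have e := mul_radonNorm_sub_eq hv hh hC α
  rw [hv, Measure.add_apply, add_eq_zero] at hμ
  have hp : 0 ≤ᵐ[p] fun x => α - h x := by
    filter_upwards [compl_mem_ae_iff.2 hμ.1] with x hx
    have := hα x (not_not.1 hx)
    simp only [Pi.zero_apply]
    linarith [le_abs_self (h x)]
  have hn : 0 ≤ᵐ[n] fun x => α + h x := by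
    filter_upwards [compl_mem_ae_iff.2 hμ.2] with x hx
    have := hα x (not_not.1 hx)
    simp only [Pi.zero_apply]
    linarith [neg_abs_le (h x)]
  have hp1 := integral_nonneg_of_ae hp
  have hn1 := integral_nonneg_of_ae hn
  -- The gap is a sum of two nonnegative integrals and is at most 0, so both vanish: h = α holds
  -- p-a.e. and h = -α holds n-a.e.
  have hp2 := (integral_eq_zero_iff_of_nonneg_ae hp ((integrable_const α).sub
    (integrable_of_continuous_of_bound hh hC))).1 (by linarith)
  have hn2 := (integral_eq_zero_iff_of_nonneg_ae hn ((integrable_const α).add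
    (integrable_of_continuous_of_bound hh hC))).1 (by linarith)
  set S := Finset.univ.image x with hS
  have hSx : (S : Set ℝ) = {y ∈ Ioo 0 T | h y = α ∨ h y = -α} := by rw [hx]; simp [hS]
  have hpS : p (S : Set ℝ)ᶜ = 0 := by
    refine compl_mem_ae_iff.1 ?_
    rw [compl_compl, hSx]
    filter_upwards [compl_mem_ae_iff.2 hμ.1, hp2] with y hy1 hy2
    refine ⟨not_not.1 hy1, Or.inl ?_⟩
    simp only [Pi.zero_apply] at hy2
    linarith
  have hnS : n (S : Set ℝ)ᶜ = 0 := by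
    refine compl_mem_ae_iff.1 ?_
    rw [compl_compl, hSx]
    filter_upwards [compl_mem_ae_iff.2 hμ.2, hn2] with y hy1 hy2
    refine ⟨not_not.1 hy1, Or.inr ?_⟩
    simp only [Pi.zero_apply] at hy2
    linarith
  have hsign : ∀ y ∈ S, p.real {y} - n.real {y} = h y / α * (p.real {y} + n.real {y}) := by
    intro y hy
    have hy' : y ∈ (S : Set ℝ) := hy
    rw [hSx] at hy'
    rcases hy'.2 with h1 | h1
    · have : n {y} = 0 := by
        refine measure_mono_null ?_ hn2
        rintro z rfl hz
        simp only [mem_ofPred_eq, Pi.zero_apply] at hz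
        linarith
      rw [measureReal_def (μ := n), this, h1, div_self hα0.ne']
      simp
    · have : p {y} = 0 := by
        refine measure_mono_null ?_ hp2
        rintro z rfl hz
        simp only [mem_ofPred_eq, Pi.zero_apply] at hz
        linarith
      rw [measureReal_def (μ := p), this, h1, neg_div, div_self hα0.ne']
      simp
  obtain ⟨P, hP⟩ := exists_forall_sum_ite_eq_sum_image x
  rw [← hS] at hP
  -- When a point is listed several times, its whole mass goes to its least index.
  refine ⟨fun j => if P j then p.real {x j} + n.real {x j} else 0, fun j => ?_, ?_, ?_⟩
  · dsimp only
    split_ifs <;> positivity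
  · ext A hA
    rw [Measure.toSignedMeasure_sub_apply hA, real_eq_sum_singleton hpS, real_eq_sum_singleton hnS,
      ← Finset.sum_sub_distrib]
    have h1 := hP fun y => if y ∈ A then h y / α * (p.real {y} + n.real {y}) else 0
    have h2 : ∑ y ∈ S, ((if y ∈ A then p.real {y} else 0) - if y ∈ A then n.real {y} else 0)
        = ∑ y ∈ S, if y ∈ A then h y / α * (p.real {y} + n.real {y}) else 0 :=
      Finset.sum_congr rfl fun y hy => by
        split_ifs
        · exact hsign y hy
        · exact sub_self 0
    rw [h2, ← h1, FunLike.coe_sum, Finset.sum_apply]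
    refine Finset.sum_congr rfl fun j _ => ?_
    rw [_root_.smul_apply, smul_eq_mul]
    by_cases hj : x j ∈ A
    · rw [VectorMeasure.dirac_apply_of_mem hA hj]
      simp [hj]
    · rw [VectorMeasure.dirac_apply_of_notMem hj]
      simp [hj]
  · have := hP fun y => p.real {y} + n.real {y}
    rw [this, radonNorm, hv, Measure.add_apply,
      ENNReal.toReal_add (measure_ne_top _ _) (measure_ne_top _ _)]
    have e1 := real_eq_sum_singleton hpS univ
    have e2 := real_eq_sum_singleton hnS univ
    simp only [mem_univ, if_true] at e1 e2
    rw [Finset.sum_add_distrib, ← e1, ← e2]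
    rfl


/-! ### First-order optimality conditions. -/

theorem nonneg_of_hasDerivAt_of_le {φ : ℝ → ℝ} {d : ℝ} (hφ : HasDerivAt φ d 0)
    (h : ∀ t ∈ Ioo (0 : ℝ) 1, φ 0 ≤ φ t) : 0 ≤ d := by
  have h1 := hφ.tendsto_slope_zero_right
  refine ge_of_tendsto h1 ?_
  filter_upwards [Ioo_mem_nhdsGT (zero_lt_one' ℝ)] with t ht
  rw [zero_add, smul_eq_mul]
  exact mul_nonneg (inv_nonneg.2 ht.1.le) (sub_nonneg.2 (h t ht))

/-- The nonsmooth term enters only through a linear bound t * r on its increment, so a one-sided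
derivative at 0 suffices and no subdifferential is needed. -/
theorem inner_gradient_add_nonneg {E : Type*} [NormedAddCommGroup E] [InnerProductSpace ℝ E]
    [CompleteSpace E] {f : E → ℝ} {u v : E} (hf : DifferentiableAt ℝ f u) {r : ℝ}
    (h : ∀ t ∈ Ioo (0 : ℝ) 1, f u ≤ f (u + t • v) + t * r) : 0 ≤ inner ℝ (∇ f u) v + r := by
  have hline : HasDerivAt (fun t : ℝ => u + t • v) v 0 := by
    simpa using ((hasDerivAt_id (0 : ℝ)).smul_const v).const_add u
  have hg : HasFDerivAt f (InnerProductSpace.toDual ℝ E (∇ f u)) (u + (0 : ℝ) • v) := by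
    simpa using hf.hasGradientAt.hasFDerivAt
  have h1 := hg.comp_hasDerivAt (0 : ℝ) hline
  have h2 := h1.add ((hasDerivAt_id (0 : ℝ)).mul_const r)
  simp only [InnerProductSpace.toDual_apply_apply, one_mul] at h2
  refine nonneg_of_hasDerivAt_of_le h2 fun t ht => ?_
  simpa using h t ht

/-- The value `α ‖μ - w‖ + β ‖ν‖` of the functional that defines the total generalized variation. -/
def tgvValue (α β T : ℝ) (μ : SignedMeasure ℝ) (w : ℝ → ℝ) (ν : SignedMeasure ℝ) : ℝ :=
  α * radonNorm (μ - densityMeasure T w) + β * radonNorm ν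

theorem tgvValue_const_mul (α β T c : ℝ) (μ : SignedMeasure ℝ) (w : ℝ → ℝ) (ν : SignedMeasure ℝ) :
    tgvValue α β T (c • μ) (fun x => c * w x) (c • ν) = |c| * tgvValue α β T μ w ν := by
  unfold tgvValue
  have e : c • μ - c • densityMeasure T w = c • (μ - densityMeasure T w) := by
    ext A _
    simp [mul_sub]
  rw [densityMeasure_const_mul, e, radonNorm_smul, radonNorm_smul]
  ring

theorem tgvValue_add_le {α β T : ℝ} (hα : 0 ≤ α) (hβ : 0 ≤ β) {w₁ w₂ : ℝ → ℝ}
    (hw₁ : Integrable w₁ (leb T)) (hw₂ : Integrable w₂ (leb T)) (μ₁ μ₂ ν₁ ν₂ : SignedMeasure ℝ) :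
    tgvValue α β T (μ₁ + μ₂) (fun x => w₁ x + w₂ x) (ν₁ + ν₂)
      ≤ tgvValue α β T μ₁ w₁ ν₁ + tgvValue α β T μ₂ w₂ ν₂ := by
  unfold tgvValue
  rw [densityMeasure_add hw₁ hw₂, add_sub_add_comm]
  have h1 := mul_le_mul_of_nonneg_left
    (radonNorm_add_le (μ₁ - densityMeasure T w₁) (μ₂ - densityMeasure T w₂)) hα
  have h2 := mul_le_mul_of_nonneg_left (radonNorm_add_le ν₁ ν₂) hβ
  linarith

section Optimality

variable {α β T : ℝ} {f : L2 T → ℝ} {ū : L2 T} {w w' : ℝ → ℝ} {μ μ' ν ν' : SignedMeasure ℝ}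

theorem IsMinimizer.le_of_tgv_le (hū : IsMinimizer α β T f ū) {r s : ℝ}
    (hr : tgv α β T ū = (r : EReal)) {u : L2 T} (hu : MemBV T u)
    (hs : tgv α β T u ≤ (s : EReal)) : f ū + r ≤ f u + s := by
  have h := (hū.2 u hu).trans (add_le_add_right hs (f u : EReal))
  rw [objective, hr] at h
  exact_mod_cast h

theorem IsMinimizer.nonneg_integral_gradient_add (hα : 0 ≤ α) (hβ : 0 ≤ β)
    (hū : IsMinimizer α β T f ū) (hf : Differentiable ℝ f) (hμ : IsDistribDeriv T ū μ)
    (hν : IsDistribDeriv T w ν) (h : tgv α β T ū = (tgvValue α β T μ w ν : EReal))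
    {v : ℝ → ℝ} (hv2 : MemLp v 2 (leb T)) (hv : IsDistribDeriv T v μ')
    (hw' : IsDistribDeriv T w' ν') :
    0 ≤ ∫ x, (∇ f ū : L2 T) x * v x ∂(leb T) + tgvValue α β T μ' w' ν' := by
  have key := inner_gradient_add_nonneg (hf ū) (v := hv2.toLp v)
    (r := tgvValue α β T μ' w' ν') fun t ht => ?_
  · rw [L2.inner_def] at key
    refine key.trans_eq ?_
    congr 1
    refine integral_congr_ae ?_
    filter_upwards [hv2.coeFn_toLp] with x hx
    rw [hx]
    simp [mul_comm]
  · have hd : IsDistribDeriv T (ū + t • hv2.toLp v : L2 T) (μ + t • μ') := by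
      refine (hμ.add (hv.const_mul t)).congr ?_
      filter_upwards [Lp.coeFn_add ū (t • hv2.toLp v), Lp.coeFn_smul t (hv2.toLp v),
        hv2.coeFn_toLp] with x h1 h2 h3
      rw [h1, Pi.add_apply, h2, Pi.smul_apply, h3, smul_eq_mul]
    have h1 := hū.le_of_tgv_le h ⟨_, hd⟩ (tgv_le hd (hν.add (hw'.const_mul t)))
    have h2 := tgvValue_add_le hα hβ hν.integrable (Integrable.const_mul hw'.integrable t)
      μ (t • μ') ν (t • ν')
    rw [tgvValue_const_mul, abs_of_pos ht.1] at h2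
    unfold tgvValue at *
    linarith

theorem IsMinimizer.tgvValue_le_neg_integral (hū : IsMinimizer α β T f ū)
    (hf : Differentiable ℝ f) (hμ : IsDistribDeriv T ū μ) (hν : IsDistribDeriv T w ν)
    (h : tgv α β T ū = (tgvValue α β T μ w ν : EReal)) :
    tgvValue α β T μ w ν ≤ -∫ x, (∇ f ū : L2 T) x * ū x ∂(leb T) := by
  have key := inner_gradient_add_nonneg (hf ū) (v := -ū)
    -- Along ū - tū = (1 - t)ū the triple (μ, w, ν) scales by 1 - t > 0, so the cost drops by
    -- exactly t times its value.
    (r := -tgvValue α β T μ w ν) fun t ht => ?_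
  · rw [inner_neg_right, L2.inner_def] at key
    have e : ∫ x, inner ℝ ((∇ f ū : L2 T) x) (ū x) ∂(leb T)
        = ∫ x, (∇ f ū : L2 T) x * ū x ∂(leb T) :=
      integral_congr_ae (Filter.Eventually.of_forall fun x => by simp [mul_comm])
    rw [e] at key
    linarith
  · have hd : IsDistribDeriv T (ū + t • -ū : L2 T) ((1 - t) • μ) := by
      refine (hμ.const_mul (1 - t)).congr ?_
      filter_upwards [Lp.coeFn_add ū (t • -ū), Lp.coeFn_smul t (-ū), Lp.coeFn_neg ū]
        with x h1 h2 h3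
      rw [h1, Pi.add_apply, h2, Pi.smul_apply, h3, Pi.neg_apply, smul_eq_mul]
      ring
    have h1 := hū.le_of_tgv_le h ⟨_, hd⟩ (tgv_le hd (hν.const_mul (1 - t)))
    have h2 := tgvValue_const_mul α β T (1 - t) μ w ν
    rw [abs_of_pos (sub_pos.2 ht.2)] at h2
    unfold tgvValue at *
    linarith

end Optimality

/-! ### The dual variables and their constraints. -/

/-- `cumul` ignores the values of the representative of ∇f(u) outside (0, T), and is therefore
bounded and continuous on the whole line, as the duality lemmas require. -/
theorem dualp_eq_cumul {T : ℝ} (f : L2 T → ℝ) (u : L2 T) {x : ℝ} (hx : x ∈ Ioo 0 T) :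
    dualp T f u x = cumul T (∇ f u : L2 T) x := by
  rw [dualp, cumul, intervalIntegral.integral_of_le hx.1.le,
    Measure.restrict_restrict measurableSet_Iic]
  congr 2
  ext t
  simp only [mem_inter_iff, mem_Iic, mem_Ioo, mem_Ioc]
  have := hx.2
  grind

theorem dualP_eq_neg_cumul {T : ℝ} (f : L2 T → ℝ) (u : L2 T) {x : ℝ} (hx : x ∈ Ioo 0 T) :
    dualP T f u x = - cumul T (cumul T (∇ f u : L2 T)) x := by
  rw [dualP, cumul, intervalIntegral.integral_of_le hx.1.le,
    Measure.restrict_restrict measurableSet_Iic,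
    show Iic x ∩ Ioo 0 T = Ioc 0 x by
      ext t
      simp only [mem_inter_iff, mem_Iic, mem_Ioo, mem_Ioc]
      have := hx.2
      grind]
  congr 1
  exact setIntegral_congr_fun measurableSet_Ioc fun t ht =>
    dualp_eq_cumul f u ⟨ht.1, ht.2.trans_lt hx.2⟩

section Dual

variable {α β T : ℝ} {g : ℝ → ℝ}

/-- `g` lies, up to sign, in the subdifferential at `0` of the total generalized variation. -/
def IsDualFeasible (α β T : ℝ) (g : ℝ → ℝ) : Prop :=
  ∀ (v : ℝ → ℝ) (μ : SignedMeasure ℝ) (w : ℝ → ℝ) (ν : SignedMeasure ℝ), MemLp v 2 (leb T) →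
    IsDistribDeriv T v μ → IsDistribDeriv T w ν →
      0 ≤ ∫ x, g x * v x ∂(leb T) + tgvValue α β T μ w ν

theorem IsDualFeasible.abs_integral_le (hg : IsDualFeasible α β T g) {v w : ℝ → ℝ}
    {μ ν : SignedMeasure ℝ} (hv2 : MemLp v 2 (leb T)) (hv : IsDistribDeriv T v μ)
    (hw : IsDistribDeriv T w ν) :
    |∫ x, g x * v x ∂(leb T)| ≤ tgvValue α β T μ w ν := by
  have h1 := hg v μ w ν hv2 hv hw
  have h2 := hg _ _ _ _ (hv2.const_mul (-1)) (hv.const_mul (-1)) (hw.const_mul (-1))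
  rw [tgvValue_const_mul] at h2
  simp_rw [mul_left_comm _ (-1 : ℝ)] at h2
  rw [integral_const_mul] at h2
  rw [abs_neg, abs_one] at h2
  rw [abs_le]
  constructor <;> linarith

theorem tgvValue_densityMeasure (α β T : ℝ) (w : ℝ → ℝ) (ν : SignedMeasure ℝ) :
    tgvValue α β T (densityMeasure T w) w ν = β * radonNorm ν := by
  rw [tgvValue, sub_self, radonNorm_zero]
  ring

/-- Constants cost nothing. -/
theorem IsDualFeasible.integral_eq_zero (hg : IsDualFeasible α β T g) :
    ∫ x, g x ∂(leb T) = 0 := by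
  have h := hg.abs_integral_le (memLp_of_continuous T continuous_const) (IsDistribDeriv.const 1)
    (IsDistribDeriv.const 0)
  rw [← densityMeasure_zero T, tgvValue_densityMeasure, densityMeasure_zero, radonNorm_zero] at h
  simpa using h

/-- The function x with w = 1 costs nothing, and its pairing with g is minus the integral of `cumul
T g`. -/
theorem IsDualFeasible.integral_cumul_eq_zero (hT : 0 < T) (hg : IsDualFeasible α β T g)
    (hgi : Integrable g (leb T)) : ∫ x, cumul T g x ∂(leb T) = 0 := by
  have h := hg.abs_integral_le (memLp_of_continuous T (g := fun x => x) continuous_id) isDistribDeriv_id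
    (IsDistribDeriv.const 1)
  rw [tgvValue_densityMeasure, radonNorm_zero, mul_zero, isDistribDeriv_id.integral_mul_eq hT hgi
    hg.integral_eq_zero, signedIntegral_densityMeasure (integrable_const 1) (continuous_cumul hgi)
    (abs_cumul_le hgi)] at h
  simpa using h

theorem signedIntegral_dirac (h : ℝ → ℝ) (x : ℝ) :
    ∫ᵛ y, h y ∂<•(VectorMeasure.dirac x (1 : ℝ)) = h x := by
  rw [VectorMeasure.integral_dirac]
  simp

/-- A unit jump at x, with w = 0, costs α and pairs with g to -`cumul T g x`. -/
theorem IsDualFeasible.abs_cumul_le (hT : 0 < T) (hg : IsDualFeasible α β T g)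
    (hgi : Integrable g (leb T)) {x : ℝ} (hx : x ∈ Ioo 0 T) : |cumul T g x| ≤ α := by
  have h := hg.abs_integral_le (memLp_jump T x) (isDistribDeriv_jump hx) (IsDistribDeriv.const 0)
  rw [(isDistribDeriv_jump hx).integral_mul_eq hT hgi hg.integral_eq_zero, signedIntegral_dirac,
    abs_neg, tgvValue, densityMeasure_zero, sub_zero, radonNorm_zero, radonNorm_dirac] at h
  simpa using h

/-- A unit kink at x, with w its derivative, costs β. The pairing is integrated by parts twice, the
second time using the zero mean of `cumul T g`. -/
theorem IsDualFeasible.abs_cumul_cumul_le (hT : 0 < T) (hg : IsDualFeasible α β T g)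
    (hgi : Integrable g (leb T)) {x : ℝ} (hx : x ∈ Ioo 0 T) :
    |cumul T (cumul T g) x| ≤ β := by
  have hk := isDistribDeriv_kinkDeriv hx
  have h := hg.abs_integral_le (memLp_kink T x) (isDistribDeriv_kink hx) hk
  rw [(isDistribDeriv_kink hx).integral_mul_eq hT hgi hg.integral_eq_zero,
    signedIntegral_densityMeasure hk.integrable (continuous_cumul hgi) (TGV1D.abs_cumul_le hgi),
    hk.integral_mul_eq hT (integrable_cumul hgi _) (hg.integral_cumul_eq_zero hT hgi),
    signedIntegral_dirac, neg_neg, tgvValue_densityMeasure, radonNorm_dirac] at h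
  simpa using h

/-- The duality pairing splits along `μ = (μ - w) + w`. -/
theorem neg_integral_mul_eq (hT : 0 < T) (hgi : Integrable g (leb T))
    (h0 : ∫ x, g x ∂(leb T) = 0) (h1 : ∫ x, cumul T g x ∂(leb T) = 0) {u w : ℝ → ℝ}
    {μ ν : SignedMeasure ℝ} (hu : IsDistribDeriv T u μ) (hw : IsDistribDeriv T w ν) :
    -∫ x, g x * u x ∂(leb T) = ∫ᵛ y, cumul T g y ∂<•(μ - densityMeasure T w)
      + ∫ᵛ y, -cumul T (cumul T g) y ∂<•ν := by
  have hi : ∀ μ : SignedMeasure ℝ, μ.Integrable (cumul T g) := fun μ => integrable_cumul hgi _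
  rw [hu.integral_mul_eq hT hgi h0, VectorMeasure.integral_sub_vectorMeasure (hi _) (hi _),
    signedIntegral_densityMeasure hw.integrable (continuous_cumul hgi) (TGV1D.abs_cumul_le hgi),
    hw.integral_mul_eq hT (integrable_cumul hgi _) h1, VectorMeasure.integral_fun_neg]
  ring

/-- The measure is the distributional derivative of u minus a primitive of w. -/
theorem IsDistribDeriv.sub_densityMeasure_concentrated {u w : ℝ → ℝ} {μ : SignedMeasure ℝ}
    (hu : IsDistribDeriv T u μ) (hw : Integrable w (leb T)) :
    (μ - densityMeasure T w).variation (Ioo 0 T)ᶜ = 0 := by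
  have := (hu.add ((isDistribDeriv_prim_densityMeasure hw).const_mul (-1))).concentrated
  have e : μ + (-1 : ℝ) • densityMeasure T w = μ - densityMeasure T w := by
    ext A _
    simp [sub_eq_add_neg]
  rwa [e] at this

end Dual

/-! ### Sparse functions and their cost. -/

section Sparse

variable {T : ℝ} {m n : ℕ} {xS : Fin m → ℝ} {xK : Fin n → ℝ}

theorem isDistribDeriv_sum_kinkDeriv (hxK : ∀ j, xK j ∈ Ioo 0 T) (c : Fin n → ℝ) (a : ℝ) :
    IsDistribDeriv T (fun x => ∑ j, c j * kinkDeriv T (xK j) x + a)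
      (∑ j, c j • VectorMeasure.dirac (xK j) 1) := by
  have h := (IsDistribDeriv.sum Finset.univ fun j _ =>
    (isDistribDeriv_kinkDeriv (hxK j)).const_mul (c j)).add (IsDistribDeriv.const (T := T) a)
  rwa [add_zero] at h

theorem isDistribDeriv_sum_jump_add_sum_kink (hxS : ∀ j, xS j ∈ Ioo 0 T)
    (hxK : ∀ j, xK j ∈ Ioo 0 T) (d : Fin m → ℝ) (c : Fin n → ℝ) (a b : ℝ) :
    IsDistribDeriv T
      (fun x => ∑ j, d j * jump T (xS j) x + ∑ j, c j * kink T (xK j) x + a * x + b)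
      (∑ j, d j • VectorMeasure.dirac (xS j) 1
        + densityMeasure T fun x => ∑ j, c j * kinkDeriv T (xK j) x + a) := by
  have h := (((IsDistribDeriv.sum Finset.univ fun j _ =>
    (isDistribDeriv_jump (hxS j)).const_mul (d j)).add (IsDistribDeriv.sum Finset.univ fun j _ =>
    (isDistribDeriv_kink (hxK j)).const_mul (c j))).add
    (isDistribDeriv_id.const_mul a)).add (IsDistribDeriv.const (T := T) b)
  have hi : ∀ j, Integrable (fun x => c j * kinkDeriv T (xK j) x) (leb T) := fun j =>
    ((isDistribDeriv_kinkDeriv (hxK j)).const_mul (c j)).integrable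
  have e : (densityMeasure T fun x => ∑ j, c j * kinkDeriv T (xK j) x + a)
      = ∑ j, c j • densityMeasure T (kinkDeriv T (xK j)) + a • densityMeasure T fun _ => 1 := by
    rw [densityMeasure_add (integrable_finsetSum _ fun j _ => hi j) (integrable_const a),
      densityMeasure_sum _ fun j _ => hi j, ← densityMeasure_const_mul a]
    simp_rw [densityMeasure_const_mul (c _), mul_one]
  rw [e, ← add_assoc]
  rwa [add_zero] at h

theorem radonNorm_sum_smul_dirac_le {N : ℕ} (x c : Fin N → ℝ) :
    radonNorm (∑ j, c j • VectorMeasure.dirac (x j) 1) ≤ ∑ j, |c j| := by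
  refine (radonNorm_sum_le _ _).trans_eq (Finset.sum_congr rfl fun j _ => ?_)
  rw [radonNorm_smul, radonNorm_dirac, abs_one, mul_one]

theorem sparseFun_eq (α β T : ℝ) (xS : Fin m → ℝ) (xK : Fin n → ℝ)
    (sS : Fin m → ℝ) (sK : Fin n → ℝ) (lS : Fin m → ℝ) (lK : Fin n → ℝ) (a b : ℝ) :
    sparseFun α β T xS xK sS sK lS lK a b = fun x =>
      ∑ j, (sS j * lS j / α) * jump T (xS j) x + ∑ j, (sK j * lK j / β) * kink T (xK j) x
        + a * x + b := by
  ext x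
  simp only [sparseFun, Finset.mul_sum]
  congr 3
  · exact Finset.sum_congr rfl fun j _ => by ring
  · exact Finset.sum_congr rfl fun j _ => by ring

/-- Taking for w the derivative of the kink and affine parts leaves only the jumps in Du - w, and
only Dirac masses at the kinks in Dw. Repeated points may cancel, hence only an inequality. -/
theorem tgv_sparseFun_le {α β : ℝ} (hα : 0 < α) (hβ : 0 < β) (hxS : ∀ j, xS j ∈ Ioo 0 T)
    (hxK : ∀ j, xK j ∈ Ioo 0 T) {sS lS : Fin m → ℝ} {sK lK : Fin n → ℝ}
    (hsS : ∀ j, |sS j| ≤ 1) (hsK : ∀ j, |sK j| ≤ 1) (hlS : ∀ j, 0 ≤ lS j) (hlK : ∀ j, 0 ≤ lK j)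
    (a b : ℝ) {u : ℝ → ℝ} (hu : sparseFun α β T xS xK sS sK lS lK a b =ᵐ[leb T] u) :
    MemBV T u ∧ tgv α β T u ≤ ((∑ j, lS j + ∑ j, lK j : ℝ) : EReal) := by
  have hd := isDistribDeriv_sum_jump_add_sum_kink hxS hxK (fun j => sS j * lS j / α)
    (fun j => sK j * lK j / β) a b
  rw [← sparseFun_eq] at hd
  refine ⟨⟨_, hd.congr hu⟩, (tgv_le (hd.congr hu)
    (isDistribDeriv_sum_kinkDeriv hxK (fun j => sK j * lK j / β) a)).trans ?_⟩
  rw [EReal.coe_le_coe_iff, add_sub_cancel_right]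
  have aux : ∀ {N : ℕ} (x s l : Fin N → ℝ) (r : ℝ), 0 < r → (∀ j, |s j| ≤ 1) → (∀ j, 0 ≤ l j) →
      r * radonNorm (∑ j, (s j * l j / r) • VectorMeasure.dirac (x j) 1) ≤ ∑ j, l j := by
    intro N x s l r hr hs hl
    refine (mul_le_mul_of_nonneg_left (radonNorm_sum_smul_dirac_le _ _) hr.le).trans ?_
    rw [Finset.mul_sum]
    refine Finset.sum_le_sum fun j _ => ?_
    rw [abs_div, abs_mul, abs_of_nonneg (hl j), abs_of_pos hr, mul_div_cancel₀ _ hr.ne']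
    exact mul_le_of_le_one_left (hl j) (hs j)
  exact add_le_add (aux _ _ _ _ hα hsS hlS) (aux _ _ _ _ hβ hsK hlK)

end Sparse

end TGV1D

end

/-! ### The main theorem. -/

theorem theorem4p8 (α β T : ℝ) (hα : 0 < α) (hβ : 0 < β) (hT : 0 < T)
    (f : TGV1D.L2 T → ℝ) (hf : Differentiable ℝ f)
    (ū : TGV1D.L2 T) (hū : TGV1D.IsMinimizer α β T f ū)
    (w : ℝ → ℝ) (Dū Dw : SignedMeasure ℝ)
    (hDū : TGV1D.IsDistribDeriv T ū Dū) (hDw : TGV1D.IsDistribDeriv T w Dw)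
    (hw : TGV1D.tgv α β T ū =
      ((α * TGV1D.radonNorm (Dū - TGV1D.densityMeasure T w) + β * TGV1D.radonNorm Dw : ℝ) : EReal))
    (NS NK : ℕ) (xS : Fin NS → ℝ) (xK : Fin NK → ℝ)
    (hxS : {x ∈ Ioo 0 T | TGV1D.dualp T f ū x = α ∨ TGV1D.dualp T f ū x = -α} = range xS)
    (hxK : {x ∈ Ioo 0 T | TGV1D.dualP T f ū x = β ∨ TGV1D.dualP T f ū x = -β} = range xK) :
    ∃ (sS : Fin NS → ℝ) (sK : Fin NK → ℝ) (lS : Fin NS → ℝ) (lK : Fin NK → ℝ) (a b : ℝ),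
      -- the signs
      (∀ j, sS j = TGV1D.dualp T f ū (xS j) / α ∧ (sS j = 1 ∨ sS j = -1)) ∧
      (∀ j, sK j = TGV1D.dualP T f ū (xK j) / β ∧ (sK j = 1 ∨ sK j = -1)) ∧
      (∀ j, 0 ≤ lS j) ∧ (∀ j, 0 ≤ lK j) ∧
      -- the sparse representation of the minimizer
      ū = TGV1D.sparse α β T xS xK sS sK lS lK a b ∧
      -- the coefficients solve the finite-dimensional problem
      IsMinOn (fun q : (Fin NS → ℝ) × (Fin NK → ℝ) × ℝ × ℝ =>
          f (TGV1D.sparse α β T xS xK sS sK q.1 q.2.1 q.2.2.1 q.2.2.2)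
            + ∑ j, q.1 j + ∑ j, q.2.1 j)
        {q | (∀ j, 0 ≤ q.1 j) ∧ (∀ j, 0 ≤ q.2.1 j)} (lS, lK, a, b) ∧
      -- the representation of `w`
      (∀ᵐ x ∂(TGV1D.leb T),
        w x = (1 / β) * ∑ j, sK j * lK j * TGV1D.kinkDeriv T (xK j) x + a) ∧
      -- the value of the functional
      TGV1D.tgv α β T ū = ((∑ j, lS j + ∑ j, lK j : ℝ) : EReal) := by
  have hα' := hα.le
  have hβ' := hβ.le
  set g : ℝ → ℝ := ⇑(∇ f ū : TGV1D.L2 T)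
  have hgi : Integrable g (TGV1D.leb T) := (Lp.memLp (∇ f ū : TGV1D.L2 T)).integrable one_le_two
  have hdual : TGV1D.IsDualFeasible α β T g := fun v μ w' ν hv2 hv hw' =>
    hū.nonneg_integral_gradient_add hα' hβ' hf hDū hDw hw hv2 hv hw'
  have hR := hū.tgvValue_le_neg_integral hf hDū hDw hw
  have hpi := TGV1D.integrable_cumul hgi (TGV1D.leb T)
  have hp0 := hdual.integral_cumul_eq_zero hT hgi
  have hxS' : ∀ j, xS j ∈ Ioo 0 T := fun j => (hxS.symm.subset (mem_range_self j)).1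
  have hxK' : ∀ j, xK j ∈ Ioo 0 T := fun j => (hxK.symm.subset (mem_range_self j)).1
  have hS : {x ∈ Ioo 0 T | TGV1D.cumul T g x = α ∨ TGV1D.cumul T g x = -α} = range xS := by
    rw [← hxS]
    ext x
    exact and_congr_right fun hx => by rw [TGV1D.dualp_eq_cumul f ū hx]
  have hK : {x ∈ Ioo 0 T | -TGV1D.cumul T (TGV1D.cumul T g) x = β ∨
      -TGV1D.cumul T (TGV1D.cumul T g) x = -β} = range xK := by
    rw [← hxK]
    ext x
    exact and_congr_right fun hx => by rw [TGV1D.dualP_eq_neg_cumul f ū hx]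
  have hPC : ∀ x, |-TGV1D.cumul T (TGV1D.cumul T g) x| ≤ ∫ x, |TGV1D.cumul T g x| ∂(TGV1D.leb T) :=
    fun x => (abs_neg _).trans_le (TGV1D.abs_cumul_le hpi x)
  have hpα : ∀ x ∈ Ioo 0 T, |TGV1D.cumul T g x| ≤ α := fun x hx => hdual.abs_cumul_le hT hgi hx
  have hPβ : ∀ x ∈ Ioo 0 T, |-TGV1D.cumul T (TGV1D.cumul T g) x| ≤ β := fun x hx =>
    (abs_neg _).trans_le (hdual.abs_cumul_cumul_le hT hgi hx)
  have hPcont : Continuous fun x => -TGV1D.cumul T (TGV1D.cumul T g) x :=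
    (TGV1D.continuous_cumul hpi).neg
  have hμ := hDū.sub_densityMeasure_concentrated hDw.integrable
  rw [TGV1D.neg_integral_mul_eq hT hgi hdual.integral_eq_zero hp0 hDū hDw, TGV1D.tgvValue] at hR
  have hle1 := TGV1D.signedIntegral_le_mul_radonNorm hμ (TGV1D.continuous_cumul hgi)
    (TGV1D.abs_cumul_le hgi) hpα
  have hle2 := TGV1D.signedIntegral_le_mul_radonNorm hDw.concentrated hPcont hPC hPβ
  -- `hR` bounds the sum of the two costs by the sum of the two pairings, while `hle1` and `hle2`
  -- bound each pairing by its cost; so both are equalities.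
  obtain ⟨c, hc, hμc, hμn⟩ := TGV1D.exists_eq_sum_dirac hα hμ (TGV1D.continuous_cumul hgi)
    (TGV1D.abs_cumul_le hgi) hpα hS (by linarith)
  obtain ⟨d, hd, hνd, hνn⟩ := TGV1D.exists_eq_sum_dirac hβ hDw.concentrated hPcont hPC hPβ hK (by linarith)
  have hpS : ∀ j, TGV1D.cumul T g (xS j) = TGV1D.dualp T f ū (xS j) := fun j =>
    (TGV1D.dualp_eq_cumul f ū (hxS' j)).symm
  have hPK : ∀ j, -TGV1D.cumul T (TGV1D.cumul T g) (xK j) = TGV1D.dualP T f ū (xK j) := fun j =>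
    (TGV1D.dualP_eq_neg_cumul f ū (hxK' j)).symm
  simp_rw [hpS] at hμc
  simp_rw [hPK] at hνd
  set sS : Fin NS → ℝ := fun j => TGV1D.dualp T f ū (xS j) / α with hsS
  set sK : Fin NK → ℝ := fun j => TGV1D.dualP T f ū (xK j) / β with hsK
  have hsS1 : ∀ j, sS j = 1 ∨ sS j = -1 := fun j => by
    rcases (hxS.symm.subset (mem_range_self j)).2 with h | h
    · left; simp only [hsS, h, div_self hα.ne']
    · right; simp only [hsS, h, neg_div, div_self hα.ne']
  have hsK1 : ∀ j, sK j = 1 ∨ sK j = -1 := fun j => by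
    rcases (hxK.symm.subset (mem_range_self j)).2 with h | h
    · left; simp only [hsK, h, div_self hβ.ne']
    · right; simp only [hsK, h, neg_div, div_self hβ.ne']
  have habs : ∀ s : ℝ, s = 1 ∨ s = -1 → |s| ≤ 1 := by
    rintro s (rfl | rfl) <;> simp
  -- With c and d the masses of the atoms, the coefficients are λˢ = αc and λᴷ = βd: the factors
  -- cancel 1/α and 1/β in `sparseFun` and are the weights in TGV.
  have hcS : ∀ j, sS j * (α * c j) / α = sS j * c j := fun j => by field_simp
  have hdK : ∀ j, sK j * (β * d j) / β = sK j * d j := fun j => by field_simp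
  rw [hνd] at hDw
  obtain ⟨a, ha⟩ := hDw.exists_ae_eq_add_const hT
    (TGV1D.isDistribDeriv_sum_kinkDeriv hxK' (fun j => sK j * d j) 0)
  simp only [add_zero] at ha
  have hdens : TGV1D.densityMeasure T w = TGV1D.densityMeasure T fun x =>
      ∑ j, sK j * d j * TGV1D.kinkDeriv T (xK j) x + a := WithDensityᵥEq.congr_ae ha
  have hDū' : Dū = ∑ j, (sS j * c j) • VectorMeasure.dirac (xS j) 1 + TGV1D.densityMeasure T fun x =>
      ∑ j, sK j * d j * TGV1D.kinkDeriv T (xK j) x + a := by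
    rw [← hdens, ← hμc, sub_add_cancel]
  rw [hDū'] at hDū
  obtain ⟨b, hb⟩ := hDū.exists_ae_eq_add_const hT
    (TGV1D.isDistribDeriv_sum_jump_add_sum_kink hxS' hxK' (fun j => sS j * c j)
      (fun j => sK j * d j) a 0)
  have hval : TGV1D.tgv α β T ū = ((∑ j, α * c j + ∑ j, β * d j : ℝ) : EReal) := by
    rw [hw, hμn, hνn, Finset.mul_sum, Finset.mul_sum]
  have hrep : ū = TGV1D.sparse α β T xS xK sS sK (fun j => α * c j) (fun j => β * d j) a b := by
    refine Lp.ext ?_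
    filter_upwards [hb, (TGV1D.memLp_sparseFun α β T xS xK sS sK (fun j => α * c j)
      (fun j => β * d j) a b).coeFn_toLp] with x h1 h2
    rw [TGV1D.sparse, h2, h1, TGV1D.sparseFun_eq]
    simp only [hcS, hdK, add_zero]
  refine ⟨sS, sK, fun j => α * c j, fun j => β * d j, a, b, fun j => ⟨rfl, hsS1 j⟩,
    fun j => ⟨rfl, hsK1 j⟩, fun j => mul_nonneg hα' (hc j), fun j => mul_nonneg hβ' (hd j), hrep,
    ?_, ?_, hval⟩
  · rintro ⟨lS, lK, a', b'⟩ ⟨hlS, hlK⟩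
    obtain ⟨h1, h2⟩ := TGV1D.tgv_sparseFun_le hα hβ hxS' hxK' (fun j => habs _ (hsS1 j))
      (fun j => habs _ (hsK1 j)) hlS hlK a' b'
      (TGV1D.memLp_sparseFun α β T xS xK sS sK lS lK a' b').coeFn_toLp.symm
    -- Minimality of ū is enough: ∑λ equals TGV at ū and bounds it from above at the competitor.
    have h3 := hū.le_of_tgv_le hval (u := TGV1D.sparse α β T xS xK sS sK lS lK a' b') h1 h2
    simp only [mem_ofPred_eq, ← hrep]
    linarith
  · filter_upwards [ha] with x hx
    rw [hx, Finset.mul_sum]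
    congr 1
    refine Finset.sum_congr rfl fun j _ => ?_
    field_simp
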